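/- Let $a\colon\mathbb R\to(0,\infty)$ be a differentiable function with locally bounded derivative such that $\int_0^\infty a(x)^{-1}\,dx=\infty=\int_{-\infty}^0 a(x)^{-1}\,dx$, and let $\rho\colon\mathbb R\to(0,\infty)$ be a $C^\infty$-function. Let $X=a\,d/dx$ and for $x_0\in\mathbb R$ let $t\mapsto e^{tX}x_0$ $(t\in\mathbb R)$ be the unique solution of $\dot x=a(x)$, $x(0)=x_0$. Let $T$ be the weak$^*$ continuous group on (complex) $L_\infty(\mathbb R;\rho\,dx)$ given by $(T_t\varphi)(y)=\varphi(e^{-tX}y)$, and let $S$ be the weak$^*$ continuous contraction semigroup on $L_\infty(\mathbb R;\rho\,dx)$ given by the weak$^*$ integral $$S_t=(4\pi t)^{-1/2}\int_{-\infty}^\infty ds\,e^{-s^2/(4t)}\,T_s\qquad(t>0).$$ For $p\in[1,\infty)$, say that $T$ (respectively $S$) extends to a continuous contraction group (respectively semigroup) on $L_p(\mathbb R;\rho\,dx)$ if there is a strongly continuous one-parameter group (respectively semigroup) of linear contractions on $L_p(\mathbb R;\rho\,dx)$ which agrees with $T$ (respectively $S$) on $L_p\cap L_\infty$. Then the following are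 equivalent. I. There is a $p\in[1,\infty)$ such that $T$ extends to a continuous contraction group on $L_p(\mathbb R;\rho\,dx)$. II. For all $p\in[1,\infty)$ the group $T$ extends to a continuous contraction group on $L_p(\mathbb R;\rho\,dx)$. III. There is a $p\in[1,\infty)$ such that $S$ extends to a continuous contraction semigroup on $L_p(\mathbb R;\rho\,dx)$. IV. For all $p\in[1,\infty)$ the semigroup $S$ extends to a continuous contraction semigroup on $L_p(\mathbb R;\rho\,dx)$. V. The function $a\rho$ is constant. -/

import Mathlib

open MeasureTheory Filter Topology
open scoped ENNReal NNReal

noncomputable section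

namespace VectorFieldSemigroup

/-- The coefficient `a` of the vector field `X = a d/dx` on `ℝ`: a strictly positive differentiable
function whose derivative is locally bounded, such that the integral of `1 / a` diverges
at `+∞` and at `-∞`. -/
structure Coefficient where
  a : ℝ → ℝ
  pos : ∀ x, 0 < a x
  differentiable : Differentiable ℝ a
  locallyBounded_deriv : ∀ x, ∃ C : ℝ, ∀ᶠ y in 𝓝 x, |deriv a y| ≤ C
  integral_atTop : Tendsto (fun R : ℝ => ∫ x in (0 : ℝ)..R, (a x)⁻¹) atTop atTop
  integral_atBot : Tendsto (fun R : ℝ => ∫ x in R..(0 : ℝ), (a x)⁻¹) atBot atTop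

/-- A strictly positive smooth density on `ℝ`. -/
structure Density where
  ρ : ℝ → ℝ
  pos : ∀ x, 0 < ρ x
  smooth : ContDiff ℝ ((⊤ : ℕ∞) : WithTop ℕ∞) ρ

/-- The measure `ρ dx`. -/
def Density.measure (w : Density) : Measure ℝ :=
  volume.withDensity fun x => ENNReal.ofReal (w.ρ x)

theorem Density.ae_iff (w : Density) {P : ℝ → Prop} :
    (∀ᵐ x ∂w.measure, P x) ↔ ∀ᵐ x, P x := by
  have hm : Measurable fun x => ENNReal.ofReal (w.ρ x) :=
    w.smooth.continuous.measurable.ennreal_ofReal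
  have h1 : w.measure ≪ volume := withDensity_absolutelyContinuous _ _
  have h2 : volume ≪ w.measure :=
    withDensity_absolutelyContinuous' hm.aemeasurable
      (Eventually.of_forall fun x => by simpa using w.pos x)
  exact ⟨fun h => h2.ae_le h, fun h => h1.ae_le h⟩

instance (w : Density) : SigmaFinite w.measure := by
  unfold Density.measure
  exact SigmaFinite.withDensity_ofReal _

namespace Coefficient

variable (X : Coefficient)

/-- The signed travel time `∫₀ˣ 1 / a` from `0` to `x`. -/
def time (x : ℝ) : ℝ := ∫ y in (0 : ℝ)..x, (X.a y)⁻¹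

theorem hasDerivAt_time (x : ℝ) : HasDerivAt X.time (X.a x)⁻¹ x :=
  ((X.differentiable.continuous.inv₀ fun y => (X.pos y).ne').integral_hasStrictDerivAt
    0 x).hasDerivAt

theorem strictMono_time : StrictMono X.time :=
  strictMono_of_deriv_pos fun x => by
    rw [(X.hasDerivAt_time x).deriv]
    exact inv_pos.2 (X.pos x)

theorem surjective_time : Function.Surjective X.time := by
  have hc : Continuous X.time :=
    continuous_iff_continuousAt.2 fun x => (X.hasDerivAt_time x).continuousAt
  refine hc.surjective X.integral_atTop ?_
  have h := tendsto_neg_atTop_atBot.comp X.integral_atBot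
  refine h.congr fun x => ?_
  simp only [Function.comp, time]
  rw [← intervalIntegral.integral_symm]

/-- The travel time as an order isomorphism of `ℝ`. -/
def timeIso : ℝ ≃o ℝ := X.strictMono_time.orderIsoOfSurjective _ X.surjective_time

/-- The initial value problem `γ' = a(γ)`, `γ 0 = x` has exactly one solution on `ℝ`. -/
theorem existsUnique_flow (x : ℝ) :
    ∃! γ : ℝ → ℝ, γ 0 = x ∧ ∀ t, HasDerivAt γ (X.a (γ t)) t := by
  have hr : ∀ u, X.time (X.timeIso.symm u) = u := fun u => X.timeIso.apply_symm_apply u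
  have hl : ∀ u, X.timeIso.symm (X.time u) = u := fun u => X.timeIso.symm_apply_apply u
  refine ⟨fun t => X.timeIso.symm (t + X.time x), ⟨by simp [hl], fun t => ?_⟩, ?_⟩
  · have h := HasDerivAt.of_local_left_inverse (f := X.time) (g := X.timeIso.symm)
      (a := t + X.time x) X.timeIso.symm.continuous.continuousAt (X.hasDerivAt_time _)
      (inv_pos.2 (X.pos _)).ne' (Eventually.of_forall hr)
    rw [inv_inv] at h
    exact h.comp_add_const t (X.time x)
  · rintro γ ⟨h0, hγ⟩
    have hd : ∀ t, HasDerivAt (fun t => X.time (γ t) - t) 0 t := fun t => by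
      have h := ((X.hasDerivAt_time (γ t)).comp t (hγ t)).sub (hasDerivAt_id t)
      rw [inv_mul_cancel₀ (X.pos _).ne', sub_self] at h
      exact h
    funext t
    have h := is_const_of_deriv_eq_zero (fun t => (hd t).differentiableAt)
      (fun t => (hd t).deriv) t 0
    simp only [h0, sub_zero] at h
    rw [← hl (γ t)]
    congr 1
    linarith

/-- The flow `e^{tX} x`: the solution at time `t` of `γ' = a(γ)`, `γ 0 = x`. -/
def flow (t x : ℝ) : ℝ := (X.existsUnique_flow x).choose t

theorem flow_zero (x : ℝ) : X.flow 0 x = x := (X.existsUnique_flow x).choose_spec.1.1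

theorem hasDerivAt_flow (t x : ℝ) : HasDerivAt (fun t => X.flow t x) (X.a (X.flow t x)) t :=
  (X.existsUnique_flow x).choose_spec.1.2 t

theorem time_flow (t x : ℝ) : X.time (X.flow t x) = t + X.time x := by
  have hd : ∀ t, HasDerivAt (fun t => X.time (X.flow t x) - t) 0 t := fun t => by
    have h := ((X.hasDerivAt_time (X.flow t x)).comp t (X.hasDerivAt_flow t x)).sub
      (hasDerivAt_id t)
    rw [inv_mul_cancel₀ (X.pos _).ne', sub_self] at h
    exact h
  have h := is_const_of_deriv_eq_zero (fun t => (hd t).differentiableAt)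
    (fun t => (hd t).deriv) t 0
  simp only [X.flow_zero, sub_zero] at h
  linarith

theorem flow_eq (t x : ℝ) : X.flow t x = X.timeIso.symm (t + X.time x) := by
  rw [← X.time_flow]
  exact (X.timeIso.symm_apply_apply _).symm

theorem continuous_flow : Continuous fun q : ℝ × ℝ => X.flow q.1 q.2 := by
  have hc : Continuous X.time :=
    continuous_iff_continuousAt.2 fun x => (X.hasDerivAt_time x).continuousAt
  simp only [flow_eq]
  exact X.timeIso.symm.continuous.comp (continuous_fst.add (hc.comp continuous_snd))

theorem volume_image_time {N : Set ℝ} (hN : volume N = 0) : volume (X.time '' N) = 0 :=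
  addHaar_image_eq_zero_of_differentiableOn_of_addHaar_eq_zero volume
    (fun x _ => (X.hasDerivAt_time x).differentiableAt.differentiableWithinAt) hN

theorem ae_symm {P : ℝ → Prop} (h : ∀ᵐ x, P x) : ∀ᵐ u, P (X.timeIso.symm u) := by
  refine measure_mono_null (fun u hu => ?_) (X.volume_image_time h)
  exact ⟨X.timeIso.symm u, hu, X.timeIso.apply_symm_apply u⟩

/-- Null sets are null along every integral curve. -/
theorem ae_flow_left {P : ℝ → Prop} (h : ∀ᵐ x, P x) (x : ℝ) : ∀ᵐ s, P (X.flow (-s) x) := by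
  simp only [flow_eq]
  have := (Measure.measurePreserving_sub_left volume (X.time x)).quasiMeasurePreserving.ae (X.ae_symm h)
  filter_upwards [this] with s hs
  rwa [neg_add_eq_sub]

/-- The flow maps preserve null sets. -/
theorem ae_flow_right {P : ℝ → Prop} (h : ∀ᵐ x, P x) (t : ℝ) : ∀ᵐ x, P (X.flow t x) := by
  have h1 := (measurePreserving_add_left volume t).quasiMeasurePreserving.ae (X.ae_symm h)
  have hc : Continuous X.time :=
    continuous_iff_continuousAt.2 fun x => (X.hasDerivAt_time x).continuousAt
  simp only [flow_eq]
  set M : Set ℝ := {u | ¬ P (X.timeIso.symm (t + u))}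
  have hM : volume M = 0 := h1
  have hd : Differentiable ℝ X.timeIso.symm := fun u => by
    refine (HasDerivAt.of_local_left_inverse (f := X.time) (g := X.timeIso.symm)
      (a := u) X.timeIso.symm.continuous.continuousAt (X.hasDerivAt_time _)
      (inv_pos.2 (X.pos _)).ne' (Eventually.of_forall fun v => ?_)).differentiableAt
    exact X.timeIso.apply_symm_apply v
  refine measure_mono_null (fun x hx => ?_)
    (addHaar_image_eq_zero_of_differentiableOn_of_addHaar_eq_zero volume
      (f := X.timeIso.symm) (s := M) hd.differentiableOn hM)
  exact ⟨X.time x, hx, X.timeIso.symm_apply_apply x⟩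

end Coefficient

/-- The Gaussian `(4 π t)^{-1/2} e^{-s² / (4 t)}`. -/
def gauss (t s : ℝ) : ℝ := (Real.sqrt (4 * Real.pi * t))⁻¹ * Real.exp (-s ^ 2 / (4 * t))

variable (X : Coefficient) (w : Density)

theorem ae_norm_le (φ : Lp ℂ ∞ w.measure) : ∀ᵐ x, ‖φ x‖ ≤ ‖φ‖ := by
  rw [← w.ae_iff]
  filter_upwards [ae_le_eLpNormEssSup (f := φ) (μ := w.measure)] with x hx
  rw [Lp.norm_def, eLpNorm_exponent_top, ← toReal_enorm]
  refine ENNReal.toReal_mono ?_ hx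
  have := (Lp.memLp φ).eLpNorm_ne_top
  rwa [eLpNorm_exponent_top] at this

theorem memLp_translate (t : ℝ) (φ : Lp ℂ ∞ w.measure) :
    MemLp (fun y => φ (X.flow (-t) y)) ∞ w.measure := by
  refine memLp_top_of_bound ?_ ‖φ‖ ?_
  · exact ((Lp.stronglyMeasurable φ).comp_measurable
      (X.continuous_flow.comp (Continuous.prodMk_right (-t))).measurable).aestronglyMeasurable
  · rw [w.ae_iff]
    exact X.ae_flow_right (ae_norm_le w φ) (-t)

/-- The group `T` on `L_∞(ℝ; ρ dx)`: `(T_t φ)(y) = φ(e^{-tX} y)`. -/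
def T (t : ℝ) (φ : Lp ℂ ∞ w.measure) : Lp ℂ ∞ w.measure :=
  (memLp_translate X w t φ).toLp _

theorem T_ae (t : ℝ) (φ : Lp ℂ ∞ w.measure) :
    ∀ᵐ y ∂w.measure, T X w t φ y = φ (X.flow (-t) y) :=
  (memLp_translate X w t φ).coeFn_toLp

theorem stronglyMeasurable_translate (φ : Lp ℂ ∞ w.measure) :
    StronglyMeasurable fun q : ℝ × ℝ => φ (X.flow (-q.2) q.1) :=
  (Lp.stronglyMeasurable φ).comp_measurable
    (X.continuous_flow.comp (continuous_snd.neg.prodMk continuous_fst)).measurable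

theorem integrable_gauss {t : ℝ} (ht : 0 < t) : Integrable (gauss t) := by
  have := (integrable_exp_neg_mul_sq (b := (4 * t)⁻¹) (by positivity)).const_mul
    (Real.sqrt (4 * Real.pi * t))⁻¹
  refine this.congr (Eventually.of_forall fun s => ?_)
  simp only [gauss]
  congr 2
  ring

theorem memLp_average {t : ℝ} (ht : 0 < t) (φ : Lp ℂ ∞ w.measure) :
    MemLp (fun y => ∫ s, (gauss t s : ℂ) * φ (X.flow (-s) y)) ∞ w.measure := by
  have hg : Continuous (gauss t) := by unfold gauss; fun_prop
  refine memLp_top_of_bound (C := ∫ s, ‖gauss t s‖ * ‖φ‖) ?_ (Eventually.of_forall fun y => ?_)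
  · have h : StronglyMeasurable fun q : ℝ × ℝ => (gauss t q.2 : ℂ) * φ (X.flow (-q.2) q.1) :=
      (Complex.continuous_ofReal.comp (hg.comp continuous_snd)).stronglyMeasurable.mul
        (stronglyMeasurable_translate X w φ)
    exact h.integral_prod_right.aestronglyMeasurable
  · refine norm_integral_le_of_norm_le ((integrable_gauss ht).norm.mul_const _) ?_
    filter_upwards [X.ae_flow_left (ae_norm_le w φ) y] with s hs
    rw [norm_mul, Complex.norm_real]
    gcongr

/-- The semigroup `S` on `L_∞(ℝ; ρ dx)`:
`S_t = (4 π t)^{-1/2} ∫ e^{-s² / (4 t)} T_s ds` for `t > 0`. -/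
def S (t : ℝ) (ht : 0 < t) (φ : Lp ℂ ∞ w.measure) : Lp ℂ ∞ w.measure :=
  (memLp_average X w ht φ).toLp _

/-- `S_t φ` is the weak* integral of `s ↦ (4 π t)^{-1/2} e^{-s² / (4 t)} T_s φ`. -/
theorem S_weakStar {t : ℝ} (ht : 0 < t) (φ : Lp ℂ ∞ w.measure) (ψ : Lp ℂ 1 w.measure) :
    ∫ y, ψ y * S X w t ht φ y ∂w.measure =
      ∫ s, (gauss t s : ℂ) * ∫ y, ψ y * T X w s φ y ∂w.measure := by
  have hg : Continuous (gauss t) := by unfold gauss; fun_prop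
  have hS : ∫ y, ψ y * S X w t ht φ y ∂w.measure =
      ∫ y, (∫ s, ψ y * ((gauss t s : ℂ) * φ (X.flow (-s) y))) ∂w.measure := by
    refine integral_congr_ae ?_
    filter_upwards [(memLp_average X w ht φ).coeFn_toLp] with y hy
    rw [integral_const_mul, ← hy]
    rfl
  rw [hS, integral_integral_swap]
  · refine integral_congr_ae (Eventually.of_forall fun s => ?_)
    simp only
    rw [← integral_const_mul]
    refine integral_congr_ae ?_
    filter_upwards [T_ae X w s φ] with y hy
    rw [hy]
    ring
  · have hb : Integrable (fun q : ℝ × ℝ => ψ q.1 * ((gauss t q.2 : ℝ) * ‖φ‖ : ℂ))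
        (w.measure.prod volume) :=
      (L1.integrable_coeFn ψ).mul_prod ((integrable_gauss ht).ofReal.mul_const _)
    refine hb.mono ?_ ?_
    · refine AEStronglyMeasurable.mul ?_ ?_
      · exact ((Lp.stronglyMeasurable ψ).comp_measurable measurable_fst).aestronglyMeasurable
      · exact ((Complex.continuous_ofReal.comp
          (hg.comp continuous_snd)).stronglyMeasurable.mul
          (stronglyMeasurable_translate X w φ)).aestronglyMeasurable
    · have hm : MeasurableSet {q : ℝ × ℝ | ‖φ (X.flow (-q.2) q.1)‖ ≤ ‖φ‖} :=
        measurableSet_le (stronglyMeasurable_translate X w φ).measurable.norm measurable_const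
      have : ∀ᵐ q ∂(w.measure.prod volume), ‖φ (X.flow (-q.2) q.1)‖ ≤ ‖φ‖ :=
        (Measure.ae_prod_iff_ae_ae hm).2
          (Eventually.of_forall fun y => X.ae_flow_left (ae_norm_le w φ) y)
      filter_upwards [this] with q hq
      simp only [Function.uncurry, norm_mul, Complex.norm_real, norm_norm]
      gcongr

/-- A strongly continuous contractive representation of the additive monoid `M` on `E`. For `M = ℝ`
this is a continuous contraction group, for `M = ℝ≥0` a continuous contraction semigroup. -/
structure IsContinuousContractive {M E : Type*} [AddMonoid M] [TopologicalSpace M]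
    [NormedAddCommGroup E] [NormedSpace ℂ E] (U : M → E →L[ℂ] E) : Prop where
  zero : U 0 = ContinuousLinearMap.id ℂ E
  add : ∀ s t, U (s + t) = (U s).comp (U t)
  continuous : ∀ φ, Continuous fun t => U t φ
  contractive : ∀ t, ‖U t‖ ≤ 1

/-- `T` extends to a continuous contraction group on `L_p(ℝ; ρ dx)`: there is such a group which
agrees with `T` on `L_p ∩ L_∞`. -/
def GroupExtends (p : ℝ≥0∞) [Fact (1 ≤ p)] : Prop :=
  ∃ U : ℝ → Lp ℂ p w.measure →L[ℂ] Lp ℂ p w.measure,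
    IsContinuousContractive U ∧
      ∀ (t : ℝ) (φ : Lp ℂ p w.measure) (φ' : Lp ℂ ∞ w.measure),
        φ =ᵐ[w.measure] φ' → U t φ =ᵐ[w.measure] T X w t φ'

/-- `S` extends to a continuous contraction semigroup on `L_p(ℝ; ρ dx)`: there is such a semigroup
which agrees with `S` on `L_p ∩ L_∞`. -/
def SemigroupExtends (p : ℝ≥0∞) [Fact (1 ≤ p)] : Prop :=
  ∃ V : ℝ≥0 → Lp ℂ p w.measure →L[ℂ] Lp ℂ p w.measure,
    IsContinuousContractive V ∧
      ∀ (t : ℝ≥0) (ht : 0 < t) (φ : Lp ℂ p w.measure) (φ' : Lp ℂ ∞ w.measure),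
        φ =ᵐ[w.measure] φ' → V t φ =ᵐ[w.measure] S X w t ht φ'

end VectorFieldSemigroup

end

/-!
In the travel time coordinate `u = ∫₀ˣ 1 / a` the flow is translation, the group `T` is the
translation group, the semigroup `S` is convolution with Gaussians, and `ρ dx` becomes `h(u) du` with
`h = a ρ` (`Coefficient.lintegral_measure`).

If `h` is constant, the flow preserves the measure, so composition with it is a strongly continuous
group of isometries of every `L_p` (`groupExtends_of_const`). Whenever `T` extends to a contraction
group `U` on `L_p`, the averages of `U` over the Gaussian measures extend `S`: they form a semigroup
since these measures form a convolution semigroup (`semigroupExtends_of_groupExtends`).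

The substantial point is that contractivity of `S` on a single `L_p` forces `h` to be constant. Put
`k = h ^ (1 / p)` and let `g` be the Gaussian at time `1`. The kernel `g(u - y) k(u) / k(y)` is then a
contraction on `L_p(du)`. Let `w` be a trapezoid that is `1` on `[-R, R]`, vanishes outside
`[-2R, 2R]` and has slopes `± 1 / R`. Pairing the image of `w ^ (2 / p)` with `w ^ (2 (p - 1) / p)`
gives at most `∫ w²`. Symmetrizing the double integral in `u` and `y` produces at least
`2 w(u) w(y)` in place of the weights, by the arithmetic-geometric mean inequality, and on `[-R, R]²`
exactly `k(u) / k(y) + k(y) / k(u)`. Since `2 w(u) w(y) = w(u)² + w(y)² - (w(u) - w(y))²`, the terms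
`∫ w²` cancel and
`∬_{[-R, R]²} g(u - y) (k(u) / k(y) + k(y) / k(u) - 2) ≤ ∬ g(u - y) (w(u) - w(y))² = O(1 / R)`
(`setLIntegral_kernel_mul_ratio_le`). Letting `R → ∞`, the nonnegative integrand on the left vanishes
identically, so `k` is constant (`eq_of_kernel_contractive`). This uses neither the generator of `S`
nor the derivative of `h`.
-/

noncomputable section

namespace VectorFieldSemigroup

open ProbabilityTheory

/-! ### The flow in the travel time coordinate -/

namespace Coefficient

variable (X : Coefficient)

theorem continuous_time : Continuous X.time :=
  continuous_iff_continuousAt.2 fun x => (X.hasDerivAt_time x).continuousAt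

theorem timeIso_symm_time (x : ℝ) : X.timeIso.symm (X.time x) = x :=
  X.timeIso.symm_apply_apply x

theorem time_timeIso_symm (u : ℝ) : X.time (X.timeIso.symm u) = u :=
  X.timeIso.apply_symm_apply u

theorem hasDerivAt_timeIso_symm (u : ℝ) :
    HasDerivAt X.timeIso.symm (X.a (X.timeIso.symm u)) u := by
  have h := HasDerivAt.of_local_left_inverse (f := X.time) (g := X.timeIso.symm)
    (a := u) X.timeIso.symm.continuous.continuousAt (X.hasDerivAt_time _)
    (inv_pos.2 (X.pos _)).ne' (Eventually.of_forall X.time_timeIso_symm)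
  rwa [inv_inv] at h

theorem flow_add (s t x : ℝ) : X.flow (s + t) x = X.flow t (X.flow s x) := by
  rw [X.flow_eq (s + t), X.flow_eq t, X.time_flow, ← add_assoc, add_comm t s]

theorem flow_timeIso_symm (t u : ℝ) : X.flow t (X.timeIso.symm u) = X.timeIso.symm (t + u) := by
  rw [flow_eq, time_timeIso_symm]

/-- The density of `ρ dx` with respect to the travel time `u`, in which `dx = a du`. -/
def timeDensity (w : Density) (u : ℝ) : ℝ :=
  X.a (X.timeIso.symm u) * w.ρ (X.timeIso.symm u)

theorem timeDensity_pos (w : Density) (u : ℝ) : 0 < X.timeDensity w u :=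
  mul_pos (X.pos _) (w.pos _)

theorem continuous_timeDensity (w : Density) : Continuous (X.timeDensity w) :=
  (X.differentiable.continuous.comp X.timeIso.symm.continuous).mul
    (w.smooth.continuous.comp X.timeIso.symm.continuous)

/-- Change of variables to the travel time; neither side needs `F` to be measurable. -/
theorem lintegral_measure (w : Density) (F : ℝ → ℝ≥0∞) :
    ∫⁻ x, F x ∂w.measure =
      ∫⁻ u, ENNReal.ofReal (X.timeDensity w u) * F (X.timeIso.symm u) := by
  have hm : Measurable fun x => ENNReal.ofReal (w.ρ x) :=
    w.smooth.continuous.measurable.ennreal_ofReal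
  have h := lintegral_image_eq_lintegral_abs_deriv_mul (s := Set.univ) MeasurableSet.univ
    (fun u _ => (X.hasDerivAt_timeIso_symm u).hasDerivWithinAt)
    X.timeIso.symm.injective.injOn (fun x => ENNReal.ofReal (w.ρ x) * F x)
  rw [Set.image_univ, X.timeIso.symm.surjective.range_eq] at h
  simp only [Measure.restrict_univ] at h
  rw [Density.measure, lintegral_withDensity_eq_lintegral_mul_non_measurable _ hm
    (Eventually.of_forall fun _ => ENNReal.ofReal_lt_top)]
  refine h.trans (lintegral_congr fun u => ?_)
  rw [abs_of_pos (X.pos _), timeDensity, ENNReal.ofReal_mul (X.pos _).le, mul_assoc]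

theorem measurePreserving_flow {w : Density} {c : ℝ} (hc : ∀ x, X.a x * w.ρ x = c) (t : ℝ) :
    MeasurePreserving (X.flow t) w.measure w.measure := by
  have hm : Measurable (X.flow t) :=
    (X.continuous_flow.comp (Continuous.prodMk_right t)).measurable
  refine ⟨hm, Measure.ext fun A hA => ?_⟩
  rw [Measure.map_apply hm hA, ← lintegral_indicator_one hA,
    ← lintegral_indicator_one (hm hA), X.lintegral_measure, X.lintegral_measure,
    ← lintegral_add_left_eq_self (fun u => _ * A.indicator 1 (X.timeIso.symm u)) t]
  refine lintegral_congr fun u => ?_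
  simp only [timeDensity, hc, ← X.flow_timeIso_symm]
  rfl

end Coefficient

instance (w : Density) : IsLocallyFiniteMeasure w.measure :=
  IsLocallyFiniteMeasure.withDensity_ofReal w.smooth.continuous

variable {X : Coefficient} {w : Density}

/-! ### Translations when `a ρ` is constant -/

theorem groupExtends_of_const {c : ℝ} (hc : ∀ x, X.a x * w.ρ x = c)
    (p : ℝ≥0∞) [Fact (1 ≤ p)] (hp : p ≠ ∞) : GroupExtends X w p := by
  have hmp := fun t => X.measurePreserving_flow hc (-t)
  have hU : ∀ t (φ : Lp ℂ p w.measure),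
      Lp.compMeasurePreserving _ (hmp t) φ =ᵐ[w.measure] φ ∘ X.flow (-t) :=
    fun t φ => Lp.coeFn_compMeasurePreserving φ (hmp t)
  refine ⟨fun t => (Lp.compMeasurePreservingₗᵢ ℂ _ (hmp t)).toContinuousLinearMap,
    ⟨?_, fun s t => ?_, fun φ => ?_, fun t => LinearIsometry.norm_toContinuousLinearMap_le _⟩,
    fun t φ φ' h => ?_⟩
  · ext1 φ
    refine Lp.ext ((hU 0 φ).trans (Eventually.of_forall fun x => ?_))
    simp [X.flow_zero]
  · ext1 φ
    refine Lp.ext ((hU (s + t) φ).trans ?_)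
    refine EventuallyEq.trans ?_ (hU s _).symm
    filter_upwards [(hmp s).quasiMeasurePreserving.ae (hU t φ)] with x hx
    refine Eq.trans ?_ hx.symm
    simp only [Function.comp, ← X.flow_add, neg_add]
  · let g : ℝ → C(ℝ, ℝ) := fun t =>
      ⟨X.flow (-t), X.continuous_flow.comp (Continuous.prodMk_right (-t))⟩
    have hg : Continuous g := ContinuousMap.continuous_of_continuous_uncurry _
      (X.continuous_flow.comp (continuous_fst.neg.prodMk continuous_snd))
    exact (continuous_const (y := φ)).compMeasurePreservingLp hg hmp hp
  · filter_upwards [hU t φ, T_ae X w t φ', (hmp t).quasiMeasurePreserving.ae h] with y h₁ h₂ h₃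
    exact h₁.trans (h₃.trans h₂.symm)

/-! ### From the group to the semigroup -/

theorem gauss_eq_gaussianPDFReal (t : ℝ≥0) : gauss t = gaussianPDFReal 0 (2 * t) := by
  funext s
  simp only [gauss, gaussianPDFReal, sub_zero]
  push_cast
  ring_nf

theorem integral_gaussianReal_eq_integral_gauss {E : Type*} [NormedAddCommGroup E]
    [NormedSpace ℝ E] {t : ℝ≥0} (ht : 0 < t) (f : ℝ → E) :
    ∫ s, f s ∂gaussianReal 0 (2 * t) = ∫ s, gauss t s • f s := by
  rw [integral_gaussianReal_eq_integral_smul (by positivity), gauss_eq_gaussianPDFReal]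

namespace IsContinuousContractive

variable {E : Type*} [NormedAddCommGroup E] [NormedSpace ℂ E] {U : ℝ → E →L[ℂ] E}

theorem norm_apply_le (hU : IsContinuousContractive U) (s : ℝ) (φ : E) : ‖U s φ‖ ≤ ‖φ‖ := by
  simpa using (U s).le_of_opNorm_le (hU.contractive s) φ

theorem integrable (hU : IsContinuousContractive U) (μ : Measure ℝ) [IsFiniteMeasure μ] (φ : E) :
    Integrable (fun s => U s φ) μ :=
  (integrable_const ‖φ‖).mono' (hU.continuous φ).aestronglyMeasurable
    (Eventually.of_forall fun s => hU.norm_apply_le s φ)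

/-- The average `φ ↦ ∫ U_s φ dμ(s)` of a contraction group over a probability measure. -/
def average (hU : IsContinuousContractive U) (μ : Measure ℝ) [IsProbabilityMeasure μ] :
    E →L[ℂ] E :=
  LinearMap.mkContinuous
    { toFun := fun φ => ∫ s, U s φ ∂μ
      map_add' := fun φ ψ => by
        simp only [map_add]
        exact integral_add (hU.integrable μ φ) (hU.integrable μ ψ)
      map_smul' := fun c φ => by
        simp only [map_smul]
        exact integral_smul c _ } 1 fun φ => by
    simpa using norm_integral_le_of_norm_le_const (μ := μ)
      (Eventually.of_forall fun s => hU.norm_apply_le s φ)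

theorem average_apply (hU : IsContinuousContractive U) (μ : Measure ℝ) [IsProbabilityMeasure μ]
    (φ : E) : hU.average μ φ = ∫ s, U s φ ∂μ := rfl

theorem clm_average [CompleteSpace E] (hU : IsContinuousContractive U) (μ : Measure ℝ)
    [IsProbabilityMeasure μ] (Λ : E →L[ℂ] ℂ) (φ : E) :
    Λ (hU.average μ φ) = ∫ s, Λ (U s φ) ∂μ :=
  (Λ.integral_comp_comm (hU.integrable μ φ)).symm

/-- Averaging a contraction group over the Gaussian measures of variance `2 t` gives a
contraction semigroup, because these measures form a convolution semigroup. -/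
theorem gaussian_average [CompleteSpace E] (hU : IsContinuousContractive U) :
    IsContinuousContractive fun t : ℝ≥0 => hU.average (gaussianReal 0 (2 * t)) where
  zero := by
    ext1 φ
    simp [average_apply, hU.zero]
  add s t := by
    ext1 φ
    have hconv : gaussianReal 0 (2 * (s + t)) =
        (gaussianReal 0 (2 * s)).conv (gaussianReal 0 (2 * t)) := by
      rw [gaussianReal_conv_gaussianReal, add_zero, mul_add]
    simp only [ContinuousLinearMap.comp_apply, average_apply]
    have hint := hU.integrable ((gaussianReal 0 (2 * s)).conv (gaussianReal 0 (2 * t))) φ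
    rw [hconv, integral_conv hint]
    refine integral_congr_ae (Eventually.of_forall fun x => ?_)
    simp only [hU.add, ContinuousLinearMap.comp_apply]
    exact (U x).integral_comp_comm (hU.integrable _ φ)
  continuous φ := by
    -- Rescaling to the standard Gaussian moves the dependence on `t` into the integrand.
    have h : ∀ t : ℝ≥0, hU.average (gaussianReal 0 (2 * t)) φ =
        ∫ z, U (Real.sqrt (2 * t) * z) φ ∂gaussianReal 0 1 := fun t => by
      have hmap := gaussianReal_map_const_mul (μ := 0) (v := 1) (Real.sqrt (2 * t))
      have hv : NNReal.mk (Real.sqrt (2 * t) ^ 2) (sq_nonneg _) * 1 = 2 * t := by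
        ext
        simp [mul_pow]
      rw [hv, mul_zero] at hmap
      rw [average_apply, ← hmap, integral_map (by fun_prop)
        (hU.continuous φ).aestronglyMeasurable]
    simp only [h]
    refine continuous_of_dominated (bound := fun _ => ‖φ‖) (fun t => ?_)
      (fun t => Eventually.of_forall fun z => hU.norm_apply_le _ φ) (integrable_const _)
      (Eventually.of_forall fun z => ?_)
    · exact ((hU.continuous φ).comp (continuous_const_mul _)).aestronglyMeasurable
    · exact (hU.continuous φ).comp (by fun_prop)
  contractive t := LinearMap.mkContinuous_norm_le _ zero_le_one _

end IsContinuousContractive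

theorem exists_clm_eq_setIntegral {μ : Measure ℝ} (p : ℝ≥0∞) [Fact (1 ≤ p)] {A : Set ℝ}
    (hA : MeasurableSet A) (hμA : μ A ≠ ∞) :
    ∃ Λ : Lp ℂ p μ →L[ℂ] ℂ, ∀ φ, Λ φ = ∫ y in A, φ y ∂μ := by
  have : Fact (1 ≤ p.conjExponent) :=
    ⟨ENNReal.HolderConjugate.one_le _ p⟩
  refine ⟨(ContinuousLinearMap.mul ℂ ℂ).lpPairing μ p.conjExponent p
    (indicatorConstLp p.conjExponent hA hμA 1), fun φ => ?_⟩
  rw [ContinuousLinearMap.lpPairing_eq_integral, ← integral_indicator hA]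
  refine integral_congr_ae ?_
  filter_upwards [indicatorConstLp_coeFn (p := p.conjExponent) (hs := hA) (hμs := hμA)
    (c := (1 : ℂ))] with y hy
  rw [hy]
  by_cases h : y ∈ A <;> simp [h]

theorem semigroupExtends_of_groupExtends {p : ℝ≥0∞} [Fact (1 ≤ p)]
    (h : GroupExtends X w p) : SemigroupExtends X w p := by
  obtain ⟨U, hU, hUT⟩ := h
  refine ⟨_, hU.gaussian_average, fun t ht φ φ' hφ => ?_⟩
  have hp1 : (1 : ℝ≥0∞) ≤ p := Fact.out
  have hloc : ∀ {q : ℝ≥0∞} (_ : 1 ≤ q) (ψ : Lp ℂ q w.measure) (A : Set ℝ),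
      w.measure A < ∞ → IntegrableOn ψ A w.measure := fun hq ψ A hA => by
    have : Fact (w.measure A < ∞) := ⟨hA⟩
    exact ((Lp.memLp ψ).restrict A).integrable hq
  -- A Bochner integral in `L_p` is not defined pointwise, so the two functions are compared through
  -- their integrals over sets of finite measure.
  refine ae_eq_of_forall_setIntegral_eq_of_sigmaFinite (fun A _ hA => hloc hp1 _ A hA)
    (fun A _ hA => hloc le_top _ A hA) fun A hA hμA => ?_
  obtain ⟨Λ, hΛ⟩ := exists_clm_eq_setIntegral p hA hμA.ne
  let ψ : Lp ℂ 1 w.measure := indicatorConstLp 1 hA hμA.ne 1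
  have hψ : ∀ F : ℝ → ℂ, ∫ y, ψ y * F y ∂w.measure = ∫ y in A, F y ∂w.measure := fun F => by
    rw [← integral_indicator hA]
    refine integral_congr_ae ?_
    filter_upwards [indicatorConstLp_coeFn (p := 1) (hs := hA) (hμs := hμA.ne) (c := (1 : ℂ))]
      with y hy
    rw [hy]
    by_cases h : y ∈ A <;> simp [h]
  rw [← hψ (S X w t ht φ'), S_weakStar X w (NNReal.coe_pos.2 ht), ← hΛ, hU.clm_average,
    integral_gaussianReal_eq_integral_gauss ht]
  refine integral_congr_ae (Eventually.of_forall fun s => ?_)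
  simp only [hψ, hΛ, Complex.real_smul]
  rw [integral_congr_ae (ae_restrict_of_ae (hUT s φ φ' hφ))]

/-! ### Weighted contractivity of a convolution forces a constant weight -/

/-- The tangent line inequality for `a ↦ a ^ p` at `b`. -/
theorem mul_rpow_sub_one_mul_le {p a b : ℝ} (hp : 1 ≤ p) (ha : 0 ≤ a) (hb : 0 ≤ b) :
    p * (b ^ (p - 1) * a) ≤ a ^ p + (p - 1) * b ^ p := by
  have hp0 : 0 < p := by linarith
  have h := Real.geom_mean_le_arith_mean2_weighted (w₁ := p⁻¹) (w₂ := 1 - p⁻¹)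
    (by positivity) (sub_nonneg.2 (inv_le_one_of_one_le₀ hp)) (Real.rpow_nonneg ha p)
    (Real.rpow_nonneg hb p) (by ring)
  rw [← Real.rpow_mul ha, ← Real.rpow_mul hb, mul_inv_cancel₀ hp0.ne', Real.rpow_one,
    mul_sub, mul_inv_cancel₀ hp0.ne', mul_one] at h
  calc p * (b ^ (p - 1) * a) = p * (a * b ^ (p - 1)) := by ring
    _ ≤ p * (p⁻¹ * a ^ p + (1 - p⁻¹) * b ^ p) := by gcongr
    _ = a ^ p + (p - 1) * b ^ p := by field_simp

/-- The tangent line inequality with `a` allowed to be infinite. -/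
theorem ofReal_mul_rpow_sub_one_mul_le {p b : ℝ} (hp : 1 ≤ p) (a : ℝ≥0∞) (hb : 0 ≤ b) :
    ENNReal.ofReal p * (ENNReal.ofReal (b ^ (p - 1)) * a) ≤
      a ^ p + ENNReal.ofReal (p - 1) * ENNReal.ofReal (b ^ p) := by
  have hp0 : 0 < p := by linarith
  rcases eq_or_ne a ∞ with rfl | ha
  · simp [ENNReal.top_rpow_of_pos hp0]
  lift a to ℝ≥0 using ha
  have ha : 0 ≤ (a : ℝ) := a.2
  have h := mul_rpow_sub_one_mul_le hp ha hb
  have h' := ENNReal.ofReal_le_ofReal h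
  rw [ENNReal.ofReal_add (by positivity) (mul_nonneg (by linarith) (by positivity)),
    ENNReal.ofReal_mul hp0.le, ENNReal.ofReal_mul (by positivity),
    ENNReal.ofReal_mul (by linarith), ← ENNReal.ofReal_rpow_of_nonneg ha hp0.le] at h'
  simpa using h'

/-- The trapezoidal cutoff, equal to `1` on `[-R, R]` and to `0` outside `[-2R, 2R]`, with slopes
`± 1 / R`. -/
def cutoff (R u : ℝ) : ℝ := max 0 (min 1 (2 - |u| / R))

theorem continuous_cutoff (R : ℝ) : Continuous (cutoff R) := by
  unfold cutoff
  fun_prop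

theorem cutoff_nonneg (R u : ℝ) : 0 ≤ cutoff R u := le_max_left _ _

theorem cutoff_le_one (R u : ℝ) : cutoff R u ≤ 1 := max_le zero_le_one (min_le_left _ _)

theorem cutoff_of_abs_le {R u : ℝ} (hR : 0 < R) (hu : |u| ≤ R) : cutoff R u = 1 := by
  have : |u| / R ≤ 1 := (div_le_one hR).2 hu
  rw [cutoff, min_eq_left (by linarith), max_eq_right zero_le_one]

theorem cutoff_of_notMem {R u : ℝ} (hR : 0 < R) (hu : u ∉ Set.Icc (-(2 * R)) (2 * R)) :
    cutoff R u = 0 := by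
  have h : 2 * R < |u| := by
    by_contra! h
    exact hu (abs_le.1 h)
  have : 2 ≤ |u| / R := (le_div_iff₀ hR).2 h.le
  exact max_eq_left ((min_le_right _ _).trans (by linarith))

theorem abs_cutoff_sub_le {R : ℝ} (hR : 0 < R) (u y : ℝ) :
    |cutoff R u - cutoff R y| ≤ R⁻¹ * |u - y| := by
  have hR' := inv_pos.2 hR
  calc |cutoff R u - cutoff R y|
      ≤ |min 1 (2 - |u| / R) - min 1 (2 - |y| / R)| := by
        simpa [cutoff] using abs_max_sub_max_le_max 0 (min 1 (2 - |u| / R)) 0 (min 1 (2 - |y| / R))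
    _ ≤ |(2 - |u| / R) - (2 - |y| / R)| := by
        simpa using abs_min_sub_min_le_max 1 (2 - |u| / R) 1 (2 - |y| / R)
    _ = R⁻¹ * |(|u| - |y|)| := by
        rw [show (2 - |u| / R) - (2 - |y| / R) = -(R⁻¹ * (|u| - |y|)) by ring, abs_neg, abs_mul,
          abs_of_pos hR']
    _ ≤ R⁻¹ * |u - y| := by
        exact mul_le_mul_of_nonneg_left (abs_abs_sub_abs_le_abs_sub u y) hR'.le

theorem lintegral_cutoff_sq_ne_top {R : ℝ} (hR : 0 < R) :
    ∫⁻ u, ENNReal.ofReal (cutoff R u ^ 2) ≠ ∞ := by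
  have hle : ∀ u, ENNReal.ofReal (cutoff R u ^ 2) ≤
      (Set.Icc (-(2 * R)) (2 * R)).indicator 1 u := fun u => by
    by_cases hu : u ∈ Set.Icc (-(2 * R)) (2 * R)
    · rw [Set.indicator_of_mem hu, Pi.one_apply, ENNReal.ofReal_le_one]
      exact pow_le_one₀ (cutoff_nonneg R u) (cutoff_le_one R u)
    · simp [cutoff_of_notMem hR hu]
  refine ((lintegral_mono hle).trans_lt ?_).ne
  rw [lintegral_indicator_one measurableSet_Icc]
  exact measure_Icc_lt_top

theorem measurableSet_abs_le_and (R : ℝ) :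
    MeasurableSet {z : ℝ × ℝ | |z.1| ≤ R ∧ |z.2| ≤ R} :=
  ((isClosed_le (f := fun z : ℝ × ℝ => |z.1|) (by fun_prop) continuous_const).inter
    (isClosed_le (f := fun z : ℝ × ℝ => |z.2|) (by fun_prop) continuous_const)).measurableSet

section Kernel

variable {g k : ℝ → ℝ}

theorem lintegral_kernel_mul_fst (hg : Continuous g) {F : ℝ → ℝ≥0∞} (hF : Measurable F) :
    ∫⁻ z : ℝ × ℝ, ENNReal.ofReal (g (z.1 - z.2)) * F z.1 =
      (∫⁻ s, ENNReal.ofReal (g s)) * ∫⁻ u, F u := by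
  have hgm := hg.measurable
  have hm : Measurable fun z : ℝ × ℝ => ENNReal.ofReal (g (z.1 - z.2)) * F z.1 := by
    fun_prop
  rw [Measure.volume_eq_prod, lintegral_prod _ hm.aemeasurable, ← lintegral_const_mul _ hF]
  refine lintegral_congr fun u => ?_
  have hgu : Measurable fun y => ENNReal.ofReal (g (u - y)) := by fun_prop
  simp only
  rw [lintegral_mul_const _ hgu, lintegral_sub_left_eq_self (fun s => ENNReal.ofReal (g s))]

theorem lintegral_comp_swap (F : ℝ × ℝ → ℝ≥0∞) : ∫⁻ z : ℝ × ℝ, F z.swap = ∫⁻ z, F z := by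
  rw [Measure.volume_eq_prod, lintegral_prod_swap]

theorem lintegral_kernel_mul_snd (hg : Continuous g) (heven : ∀ s, g (-s) = g s)
    {F : ℝ → ℝ≥0∞} (hF : Measurable F) :
    ∫⁻ z : ℝ × ℝ, ENNReal.ofReal (g (z.1 - z.2)) * F z.2 =
      (∫⁻ s, ENNReal.ofReal (g s)) * ∫⁻ u, F u := by
  rw [← lintegral_kernel_mul_fst hg hF, ← lintegral_comp_swap]
  refine lintegral_congr fun z => ?_
  rw [Prod.fst_swap, Prod.snd_swap, ← heven, neg_sub]

/-- The Dirichlet form of the cutoff for the kernel `g` is of order `1 / R`. -/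
theorem lintegral_kernel_mul_cutoff_sub_sq_le (hg : Continuous g) (h0 : ∀ s, 0 ≤ g s)
    (heven : ∀ s, g (-s) = g s) {R : ℝ} (hR : 0 < R) :
    ∫⁻ z : ℝ × ℝ, ENNReal.ofReal (g (z.1 - z.2) * (cutoff R z.1 - cutoff R z.2) ^ 2) ≤
      ENNReal.ofReal (8 / R) * ∫⁻ s, ENNReal.ofReal (g s * s ^ 2) := by
  set χ : ℝ → ℝ≥0∞ := (Set.Icc (-(2 * R)) (2 * R)).indicator 1 with hχ
  have hχm : Measurable χ := measurable_one.indicator measurableSet_Icc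
  have hχint : ∫⁻ u, χ u = ENNReal.ofReal (4 * R) := by
    rw [hχ, lintegral_indicator_one measurableSet_Icc, Real.volume_Icc]
    congr 1
    ring
  have hg2 : Continuous fun s => g s * s ^ 2 := hg.mul (continuous_pow 2)
  have hle : ∀ z : ℝ × ℝ,
      ENNReal.ofReal (g (z.1 - z.2) * (cutoff R z.1 - cutoff R z.2) ^ 2) ≤
        ENNReal.ofReal (R⁻¹ ^ 2) *
          (ENNReal.ofReal (g (z.1 - z.2) * (z.1 - z.2) ^ 2) * χ z.1 +
            ENNReal.ofReal (g (z.1 - z.2) * (z.1 - z.2) ^ 2) * χ z.2) := by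
    rintro ⟨u, y⟩
    rw [← mul_add]
    by_cases h : u ∉ Set.Icc (-(2 * R)) (2 * R) ∧ y ∉ Set.Icc (-(2 * R)) (2 * R)
    · simp [cutoff_of_notMem hR h.1, cutoff_of_notMem hR h.2]
    have h1 : 1 ≤ χ u + χ y := by
      rw [not_and_or, not_not, not_not] at h
      rcases h with h | h
      · exact le_add_right (by simp [hχ, Set.indicator_of_mem h])
      · exact le_add_left (by simp [hχ, Set.indicator_of_mem h])
    have h2 : (cutoff R u - cutoff R y) ^ 2 ≤ R⁻¹ ^ 2 * (u - y) ^ 2 := by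
      rw [← mul_pow, sq_le_sq, abs_mul, abs_of_pos (inv_pos.2 hR)]
      exact abs_cutoff_sub_le hR u y
    calc ENNReal.ofReal (g (u - y) * (cutoff R u - cutoff R y) ^ 2)
        ≤ ENNReal.ofReal (R⁻¹ ^ 2 * (g (u - y) * (u - y) ^ 2)) := by
          refine ENNReal.ofReal_le_ofReal ?_
          rw [mul_left_comm]
          exact mul_le_mul_of_nonneg_left h2 (h0 _)
      _ = ENNReal.ofReal (R⁻¹ ^ 2) * (ENNReal.ofReal (g (u - y) * (u - y) ^ 2) * 1) := by
          rw [ENNReal.ofReal_mul (by positivity), mul_one]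
      _ ≤ _ := by gcongr
  have hm : Measurable fun z : ℝ × ℝ =>
      ENNReal.ofReal (g (z.1 - z.2) * (z.1 - z.2) ^ 2) * χ z.1 := by
    have := hg.measurable
    fun_prop
  refine (lintegral_mono hle).trans_eq ?_
  rw [lintegral_const_mul' _ _ ENNReal.ofReal_ne_top, lintegral_add_left hm,
    lintegral_kernel_mul_fst hg2 hχm, lintegral_kernel_mul_snd hg2 (by simp [heven]) hχm, hχint,
    ← mul_add, ← ENNReal.ofReal_add (by positivity) (by positivity), mul_left_comm, mul_comm,
    ← ENNReal.ofReal_mul (by positivity)]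
  congr 2
  field_simp
  norm_num

/-- A form of Hölder's inequality: the convolution of `b / k` with the kernel, multiplied by `k`, is
tested against `b ^ (p - 1)`. The tangent line inequality covers `p = 1` on the same footing. -/
theorem lintegral_kernel_mul_weight_le {p : ℝ} (hp : 1 ≤ p) (hg : Continuous g)
    (hk : Continuous k) (hk0 : ∀ u, 0 < k u) {b : ℝ → ℝ} (hb : Continuous b)
    (hb0 : ∀ u, 0 ≤ b u)
    (H : ∫⁻ u, (ENNReal.ofReal (k u) * ∫⁻ y, ENNReal.ofReal (g (u - y) * (b y / k y))) ^ p ≤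
      ∫⁻ u, ENNReal.ofReal (b u ^ p)) :
    ∫⁻ z : ℝ × ℝ, ENNReal.ofReal
        (g (z.1 - z.2) * (b z.2 * b z.1 ^ (p - 1) * (k z.1 / k z.2))) ≤
      ∫⁻ u, ENNReal.ofReal (b u ^ p) := by
  have hp0 : 0 < p := by linarith
  have hgm := hg.measurable
  have hkm := hk.measurable
  have hbm := hb.measurable
  have hm : Measurable fun z : ℝ × ℝ => ENNReal.ofReal
      (g (z.1 - z.2) * (b z.2 * b z.1 ^ (p - 1) * (k z.1 / k z.2))) := by
    fun_prop
  have hin : ∀ u, ∫⁻ y, ENNReal.ofReal (g (u - y) * (b y * b u ^ (p - 1) * (k u / k y))) =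
      ENNReal.ofReal (b u ^ (p - 1)) *
        (ENNReal.ofReal (k u) * ∫⁻ y, ENNReal.ofReal (g (u - y) * (b y / k y))) := fun u => by
    rw [← mul_assoc, ← ENNReal.ofReal_mul (Real.rpow_nonneg (hb0 u) _),
      ← lintegral_const_mul' _ _ ENNReal.ofReal_ne_top]
    refine lintegral_congr fun y => ?_
    rw [← ENNReal.ofReal_mul (mul_nonneg (Real.rpow_nonneg (hb0 u) _) (hk0 u).le)]
    congr 1
    ring
  rw [Measure.volume_eq_prod, lintegral_prod _ hm.aemeasurable]
  simp only [hin]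
  refine (ENNReal.mul_le_mul_iff_right (a := ENNReal.ofReal p) (by simpa using hp0)
    ENNReal.ofReal_ne_top).1 ?_
  rw [← lintegral_const_mul' _ _ ENNReal.ofReal_ne_top]
  refine (lintegral_mono fun u => ofReal_mul_rpow_sub_one_mul_le hp _ (hb0 u)).trans ?_
  rw [lintegral_add_right _ (by fun_prop), lintegral_const_mul' _ _ ENNReal.ofReal_ne_top]
  refine (add_le_add_left H _).trans_eq ?_
  rw [← one_add_mul, ← ENNReal.ofReal_one, ← ENNReal.ofReal_add zero_le_one (by linarith),
    add_sub_cancel]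

/-- If `f ↦ g * f` is a contraction on the `L_p` space of the weight `k ^ p`, then the kernel `g`
sees little variation of `log k` on `[-R, R]`: the integrand `k u / k y + k y / k u - 2` vanishes
only if `k u = k y`. -/
theorem setLIntegral_kernel_mul_ratio_le {p : ℝ} (hp : 1 ≤ p) (hg : Continuous g)
    (h0 : ∀ s, 0 ≤ g s) (heven : ∀ s, g (-s) = g s) (h1 : ∫⁻ s, ENNReal.ofReal (g s) = 1)
    (hk : Continuous k) (hk0 : ∀ u, 0 < k u)
    (H : ∀ f : ℝ → ℝ, Continuous f → HasCompactSupport f → (∀ u, 0 ≤ f u) →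
      ∫⁻ u, (ENNReal.ofReal (k u) * ∫⁻ y, ENNReal.ofReal (g (u - y) * f y)) ^ p ≤
        ∫⁻ u, ENNReal.ofReal ((k u * f u) ^ p)) {R : ℝ} (hR : 0 < R) :
    ∫⁻ z in {z : ℝ × ℝ | |z.1| ≤ R ∧ |z.2| ≤ R},
        ENNReal.ofReal (g (z.1 - z.2) * (k z.1 / k z.2 + k z.2 / k z.1 - 2)) ≤
      ENNReal.ofReal (8 / R) * ∫⁻ s, ENNReal.ofReal (g s * s ^ 2) := by
  have hp0 : 0 < p := by linarith
  set w := cutoff R with hw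
  have hwc : Continuous w := continuous_cutoff R
  have hw0 : ∀ u, 0 ≤ w u := cutoff_nonneg R
  -- With this exponent `b ^ p = w ^ 2`, so the bounds below are quadratic in the cutoff.
  set b : ℝ → ℝ := fun u => w u ^ (2 / p) with hbdef
  have hbc : Continuous b := hwc.rpow_const fun _ => Or.inr (by positivity)
  have hb0 : ∀ u, 0 ≤ b u := fun u => Real.rpow_nonneg (hw0 u) _
  have hbp : ∀ u, b u ^ p = w u ^ 2 := fun u => by
    rw [hbdef, ← Real.rpow_mul (hw0 u), div_mul_cancel₀ _ hp0.ne', Real.rpow_two]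
  have hbb : ∀ u, b u * b u ^ (p - 1) = w u ^ 2 := fun u => by
    rw [← hbp, ← Real.rpow_one_add' (hb0 u) (by simpa using hp0.ne'), add_sub_cancel]
  have hbs : HasCompactSupport fun y => b y / k y := by
    refine HasCompactSupport.intro (isCompact_Icc (a := -(2 * R)) (b := 2 * R)) fun u hu => ?_
    rw [hbdef, hw]
    simp only [cutoff_of_notMem hR hu]
    rw [Real.zero_rpow (by positivity), zero_div]
  set A : ℝ × ℝ → ℝ := fun z =>
    g (z.1 - z.2) * (b z.2 * b z.1 ^ (p - 1) * (k z.1 / k z.2)) with hA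
  have hA0 : ∀ z, 0 ≤ A z := fun z => mul_nonneg (h0 _) (mul_nonneg (mul_nonneg (hb0 _)
    (Real.rpow_nonneg (hb0 _) _)) (div_nonneg (hk0 _).le (hk0 _).le))
  set I := ∫⁻ u, ENNReal.ofReal (w u ^ 2) with hI
  have hIfin : I ≠ ∞ := lintegral_cutoff_sq_ne_top hR
  have hAI : ∫⁻ z, ENNReal.ofReal (A z) ≤ I := by
    refine (lintegral_kernel_mul_weight_le hp hg hk hk0 hbc hb0 ?_).trans_eq (by simp [hbp, hI])
    refine (H (fun y => b y / k y) (hbc.div hk fun u => (hk0 u).ne') hbs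
      fun u => div_nonneg (hb0 u) (hk0 u).le).trans_eq (lintegral_congr fun u => ?_)
    rw [mul_div_cancel₀ _ (hk0 u).ne']
  set D : ℝ × ℝ → ℝ := fun z => g (z.1 - z.2) * (k z.1 / k z.2 + k z.2 / k z.1 - 2) with hD
  set S : Set (ℝ × ℝ) := {z | |z.1| ≤ R ∧ |z.2| ≤ R} with hS
  have hSm : MeasurableSet S := measurableSet_abs_le_and R
  -- Where the cutoff is `1` the two weighted kernels add up to `D` and `2 g`; elsewhere the
  -- arithmetic-geometric mean inequality bounds them below.
  have hpt : ∀ z, S.indicator (fun z => ENNReal.ofReal (D z)) z +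
      (ENNReal.ofReal (g (z.1 - z.2)) * ENNReal.ofReal (w z.1 ^ 2) +
        ENNReal.ofReal (g (z.1 - z.2)) * ENNReal.ofReal (w z.2 ^ 2)) ≤
      ENNReal.ofReal (g (z.1 - z.2) * (w z.1 - w z.2) ^ 2) +
        (ENNReal.ofReal (A z) + ENNReal.ofReal (A z.swap)) := by
    rintro ⟨u, y⟩
    have hr : 0 < k u / k y := div_pos (hk0 u) (hk0 y)
    have hr' : 0 < k y / k u := div_pos (hk0 y) (hk0 u)
    have hrr : k u / k y * (k y / k u) = 1 := by
      have := (hk0 u).ne'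
      have := (hk0 y).ne'
      field_simp
    have hgs : g (y - u) = g (u - y) := by rw [← heven, neg_sub]
    have hsum : A (u, y) + A (y, u) = g (u - y) *
        (b y * b u ^ (p - 1) * (k u / k y) + b u * b y ^ (p - 1) * (k y / k u)) := by
      simp only [hA, hgs]
      ring
    simp only [Prod.swap_prod_mk]
    rw [← ENNReal.ofReal_mul (h0 _), ← ENNReal.ofReal_mul (h0 _),
      ← ENNReal.ofReal_add (mul_nonneg (h0 _) (sq_nonneg _)) (mul_nonneg (h0 _) (sq_nonneg _)),
      ← ENNReal.ofReal_add (hA0 _) (hA0 _), hsum,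
      ← ENNReal.ofReal_add (mul_nonneg (h0 _) (sq_nonneg _)) (hsum ▸ add_nonneg (hA0 _) (hA0 _))]
    by_cases hz : (u, y) ∈ S
    · have hwu : w u = 1 := cutoff_of_abs_le hR hz.1
      have hwy : w y = 1 := cutoff_of_abs_le hR hz.2
      have hDz : 0 ≤ D (u, y) :=
        mul_nonneg (h0 _) (by nlinarith [sq_nonneg (k u / k y - k y / k u)])
      rw [Set.indicator_of_mem hz, ← ENNReal.ofReal_add hDz (add_nonneg
        (mul_nonneg (h0 _) (sq_nonneg _)) (mul_nonneg (h0 _) (sq_nonneg _)))]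
      refine ENNReal.ofReal_le_ofReal (le_of_eq ?_)
      simp only [hD, hbdef, hwu, hwy, Real.one_rpow]
      ring
    · rw [Set.indicator_of_notMem hz, zero_add]
      refine ENNReal.ofReal_le_ofReal ?_
      rw [← mul_add, ← mul_add]
      refine mul_le_mul_of_nonneg_left ?_ (h0 _)
      set α := b y * b u ^ (p - 1) * (k u / k y) with hα
      set β := b u * b y ^ (p - 1) * (k y / k u) with hβ
      have hα0 : 0 ≤ α := mul_nonneg (mul_nonneg (hb0 _) (Real.rpow_nonneg (hb0 _) _)) hr.le
      have hβ0 : 0 ≤ β := mul_nonneg (mul_nonneg (hb0 _) (Real.rpow_nonneg (hb0 _) _)) hr'.le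
      have hαβ : α * β = (w u * w y) ^ 2 := by
        calc α * β = (b u * b u ^ (p - 1)) * (b y * b y ^ (p - 1)) *
              (k u / k y * (k y / k u)) := by rw [hα, hβ]; ring
          _ = (w u * w y) ^ 2 := by rw [hbb, hbb, hrr]; ring
      have hamgm : 2 * (w u * w y) ≤ α + β := by
        refine le_of_sq_le_sq ?_ (by positivity)
        nlinarith [sq_nonneg (α - β)]
      nlinarith
  have hgm := hg.measurable
  have hwm := hwc.measurable
  have hbm := hbc.measurable
  have hkm := hk.measurable
  have hAm : Measurable fun z => ENNReal.ofReal (A z) := by fun_prop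
  have hint := lintegral_mono (μ := volume) hpt
  rw [lintegral_add_right _ (by fun_prop), lintegral_add_left (by fun_prop),
    lintegral_add_right _ (by fun_prop), lintegral_add_left hAm,
    lintegral_comp_swap fun z => ENNReal.ofReal (A z), lintegral_indicator hSm,
    lintegral_kernel_mul_fst hg (F := fun u => ENNReal.ofReal (w u ^ 2)) (by fun_prop),
    lintegral_kernel_mul_snd hg heven (F := fun u => ENNReal.ofReal (w u ^ 2)) (by fun_prop),
    h1, one_mul, ← hI] at hint
  refine (ENNReal.add_le_add_iff_right (ENNReal.add_ne_top.2 ⟨hIfin, hIfin⟩)).1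
    (hint.trans (add_le_add ?_ (add_le_add hAI hAI)))
  exact lintegral_kernel_mul_cutoff_sub_sq_le hg h0 heven hR

/-- A weight on which convolution with a positive even kernel of mass one and finite variance is a
contraction is constant. -/
theorem eq_of_kernel_contractive {p : ℝ} (hp : 1 ≤ p) (hg : Continuous g)
    (h0 : ∀ s, 0 < g s) (heven : ∀ s, g (-s) = g s) (h1 : ∫⁻ s, ENNReal.ofReal (g s) = 1)
    (h2 : ∫⁻ s, ENNReal.ofReal (g s * s ^ 2) ≠ ∞) (hk : Continuous k) (hk0 : ∀ u, 0 < k u)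
    (H : ∀ f : ℝ → ℝ, Continuous f → HasCompactSupport f → (∀ u, 0 ≤ f u) →
      ∫⁻ u, (ENNReal.ofReal (k u) * ∫⁻ y, ENNReal.ofReal (g (u - y) * f y)) ^ p ≤
        ∫⁻ u, ENNReal.ofReal ((k u * f u) ^ p)) (u y : ℝ) : k u = k y := by
  set D : ℝ × ℝ → ℝ := fun z => g (z.1 - z.2) * (k z.1 / k z.2 + k z.2 / k z.1 - 2) with hD
  have hDc : Continuous fun z => ENNReal.ofReal (D z) := by
    refine ENNReal.continuous_ofReal.comp ?_
    refine (hg.comp (by fun_prop)).mul (Continuous.sub (Continuous.add ?_ ?_) continuous_const)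
    · exact (hk.comp continuous_fst).div (hk.comp continuous_snd) fun z => (hk0 _).ne'
    · exact (hk.comp continuous_snd).div (hk.comp continuous_fst) fun z => (hk0 _).ne'
  have hzero : ∀ n : ℕ, ∫⁻ z in {z : ℝ × ℝ | |z.1| ≤ n ∧ |z.2| ≤ n}, ENNReal.ofReal (D z) = 0 := by
    intro n
    have hlim : Tendsto (fun R : ℝ => ENNReal.ofReal (8 / R) *
        ∫⁻ s, ENNReal.ofReal (g s * s ^ 2)) atTop (𝓝 0) := by
      have h := ENNReal.Tendsto.mul_const (b := ∫⁻ s, ENNReal.ofReal (g s * s ^ 2))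
        (ENNReal.tendsto_ofReal
          (tendsto_const_nhds.div_atTop tendsto_id : Tendsto (fun R : ℝ => 8 / R) atTop (𝓝 0)))
        (Or.inr h2)
      simpa using h
    refine le_antisymm (ge_of_tendsto hlim ?_) (zero_le)
    filter_upwards [eventually_ge_atTop (n : ℝ), eventually_gt_atTop 0] with R hnR hR
    refine le_trans (lintegral_mono_set fun z hz => ?_)
      (setLIntegral_kernel_mul_ratio_le hp hg (fun s => (h0 s).le) heven h1 hk hk0 H hR)
    exact ⟨hz.1.trans hnR, hz.2.trans hnR⟩
  have hae : (fun z => ENNReal.ofReal (D z)) =ᵐ[volume] fun _ => 0 := by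
    have hn : ∀ n : ℕ, ∀ᵐ z : ℝ × ℝ, (|z.1| ≤ n ∧ |z.2| ≤ n) → ENNReal.ofReal (D z) = 0 :=
      fun n =>
        (setLIntegral_eq_zero_iff (measurableSet_abs_le_and n) hDc.measurable).1 (hzero n)
    filter_upwards [ae_all_iff.2 hn] with z hz
    obtain ⟨n, hn⟩ := exists_nat_ge (max |z.1| |z.2|)
    exact hz n ⟨(le_max_left _ _).trans hn, (le_max_right _ _).trans hn⟩
  have hall := (Continuous.ae_eq_iff_eq volume hDc continuous_const).1 hae
  have hD0 : D (u, y) ≤ 0 := ENNReal.ofReal_eq_zero.1 (congrFun hall (u, y))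
  have hu := hk0 u
  have hy := hk0 y
  have h3 : k u / k y + k y / k u - 2 ≤ 0 := nonpos_of_mul_nonpos_right hD0 (h0 _)
  have h4 : k u / k y + k y / k u - 2 = (k u - k y) ^ 2 / (k u * k y) := by
    field_simp
    ring
  rw [h4, div_le_iff₀ (by positivity), zero_mul] at h3
  nlinarith [pow_eq_zero_iff (two_ne_zero) |>.1 (le_antisymm h3 (sq_nonneg (k u - k y)))]

end Kernel

/-! ### Contractivity of the semigroup -/

theorem continuous_gauss (t : ℝ) : Continuous (gauss t) := by
  unfold gauss
  fun_prop

theorem gauss_pos {t : ℝ} (ht : 0 < t) (s : ℝ) : 0 < gauss t s := by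
  unfold gauss
  positivity

theorem gauss_neg (t s : ℝ) : gauss t (-s) = gauss t s := by
  rw [gauss, neg_sq, gauss]

theorem lintegral_gauss {t : ℝ≥0} (ht : 0 < t) : ∫⁻ s, ENNReal.ofReal (gauss t s) = 1 := by
  rw [gauss_eq_gaussianPDFReal]
  exact lintegral_gaussianPDFReal_eq_one 0 (by positivity)

theorem lintegral_gauss_mul_sq_ne_top {t : ℝ} (ht : 0 < t) :
    ∫⁻ s, ENNReal.ofReal (gauss t s * s ^ 2) ≠ ∞ := by
  have h : Integrable fun s => gauss t s * s ^ 2 := by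
    have := (integrable_rpow_mul_exp_neg_mul_sq (b := (4 * t)⁻¹) (s := 2) (by positivity)
      (by norm_num)).const_mul (Real.sqrt (4 * Real.pi * t))⁻¹
    refine this.congr (Eventually.of_forall fun s => ?_)
    simp only [gauss, Real.rpow_two]
    rw [show -(4 * t)⁻¹ * s ^ 2 = -s ^ 2 / (4 * t) by ring]
    ring
  exact h.lintegral_lt_top.ne

variable {X : Coefficient} {w : Density}

/-- In the travel time coordinate the semigroup is convolution with the Gaussian. -/
theorem S_ae_eq_convolution {t : ℝ} (ht : 0 < t) {f : ℝ → ℝ} (hf : Continuous f)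
    (hfs : HasCompactSupport f) (hf0 : ∀ u, 0 ≤ f u) {φ : Lp ℂ ∞ w.measure}
    (hφ : φ =ᵐ[w.measure] fun x => (f (X.time x) : ℂ)) :
    ∀ᵐ x ∂w.measure, ‖S X w t ht φ x‖ₑ =
      ∫⁻ y, ENNReal.ofReal (gauss t (X.time x - y) * f y) := by
  have hg := continuous_gauss t
  obtain ⟨C, hC⟩ := hfs.exists_bound_of_continuous hf
  filter_upwards [(memLp_average X w ht φ).coeFn_toLp] with x hx
  have hint : Integrable fun s => gauss t s * f (X.time x - s) := by
    refine (integrable_gauss ht).mul_bdd (c := C) ?_ (Eventually.of_forall fun s => hC _)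
    exact (hf.comp (continuous_const.sub continuous_id)).aestronglyMeasurable
  have h0 : ∀ s, 0 ≤ gauss t s * f (X.time x - s) := fun s =>
    mul_nonneg (gauss_pos ht s).le (hf0 _)
  have hS : S X w t ht φ x = ((∫ s, gauss t s * f (X.time x - s) : ℝ) : ℂ) := by
    refine Eq.trans hx ?_
    rw [← integral_complex_ofReal]
    refine integral_congr_ae ?_
    filter_upwards [X.ae_flow_left (w.ae_iff.1 hφ) x] with s hs
    rw [hs, X.time_flow, neg_add_eq_sub, Complex.ofReal_mul]
  rw [hS, ← ofReal_norm, Complex.norm_real, Real.norm_of_nonneg (integral_nonneg h0),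
    ofReal_integral_eq_lintegral_ofReal hint (Eventually.of_forall h0),
    ← lintegral_sub_left_eq_self _ (X.time x)]
  simp only [sub_sub_cancel]

/-- Contractivity on `L_p(ρ dx)`, written in the travel time coordinate. -/
theorem lintegral_convolution_le_of_semigroupExtends {p : ℝ≥0∞} [Fact (1 ≤ p)] (hp : p ≠ ∞)
    (h : SemigroupExtends X w p) {t : ℝ≥0} (ht : 0 < t) {f : ℝ → ℝ} (hf : Continuous f)
    (hfs : HasCompactSupport f) (hf0 : ∀ u, 0 ≤ f u) :
    ∫⁻ u, ENNReal.ofReal (X.timeDensity w u) *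
        (∫⁻ y, ENNReal.ofReal (gauss t (u - y) * f y)) ^ p.toReal ≤
      ∫⁻ u, ENNReal.ofReal (X.timeDensity w u) * ENNReal.ofReal (f u) ^ p.toReal := by
  obtain ⟨V, hV, hVS⟩ := h
  have hp1 : (1 : ℝ≥0∞) ≤ p := Fact.out
  have hp0 : p ≠ 0 := (zero_lt_one.trans_le hp1).ne'
  have hpr : 0 < p.toReal := ENNReal.toReal_pos hp0 hp
  have hFc : Continuous fun x => (f (X.time x) : ℂ) :=
    Complex.continuous_ofReal.comp (hf.comp X.continuous_time)
  have hFs : HasCompactSupport fun x => (f (X.time x) : ℂ) :=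
    (hfs.comp_homeomorph X.timeIso.toHomeomorph).comp_left (g := fun r : ℝ => (r : ℂ)) rfl
  have hmem : ∀ q, MemLp (fun x => (f (X.time x) : ℂ)) q w.measure := fun q =>
    hFc.memLp_of_hasCompactSupport hFs
  set φ := (hmem p).toLp _ with hφdef
  set φ' := (hmem ∞).toLp _ with hφ'def
  have hφ := (hmem p).coeFn_toLp
  have hφ' := (hmem ∞).coeFn_toLp
  have hVφ := hVS t (NNReal.coe_pos.2 ht) φ φ' (hφ.trans hφ'.symm)
  have hnorm : ‖V t φ‖ ≤ ‖φ‖ := by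
    simpa using (V t).le_of_opNorm_le (hV.contractive t) φ
  have hnorm' : eLpNorm (V t φ) p w.measure ≤ eLpNorm φ p w.measure := by
    rw [Lp.norm_def, Lp.norm_def] at hnorm
    exact (ENNReal.toReal_le_toReal (Lp.memLp _).eLpNorm_ne_top
      (Lp.memLp _).eLpNorm_ne_top).1 hnorm
  rw [eLpNorm_eq_lintegral_rpow_enorm_toReal hp0 hp,
    eLpNorm_eq_lintegral_rpow_enorm_toReal hp0 hp,
    ENNReal.rpow_le_rpow_iff (by positivity)] at hnorm'
  have hleft : ∫⁻ x, ‖V t φ x‖ₑ ^ p.toReal ∂w.measure =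
      ∫⁻ u, ENNReal.ofReal (X.timeDensity w u) *
        (∫⁻ y, ENNReal.ofReal (gauss t (u - y) * f y)) ^ p.toReal := by
    rw [lintegral_congr_ae (g := fun x =>
      (∫⁻ y, ENNReal.ofReal (gauss t (X.time x - y) * f y)) ^ p.toReal), X.lintegral_measure]
    · simp only [X.time_timeIso_symm]
    · filter_upwards [hVφ, S_ae_eq_convolution (NNReal.coe_pos.2 ht) hf hfs hf0 hφ'] with x h₁ h₂
      rw [h₁, h₂]
  have hright : ∫⁻ x, ‖φ x‖ₑ ^ p.toReal ∂w.measure =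
      ∫⁻ u, ENNReal.ofReal (X.timeDensity w u) * ENNReal.ofReal (f u) ^ p.toReal := by
    rw [lintegral_congr_ae (g := fun x => ENNReal.ofReal (f (X.time x)) ^ p.toReal),
      X.lintegral_measure]
    · simp only [X.time_timeIso_symm]
    · filter_upwards [hφ] with x hx
      rw [hx, ← ofReal_norm, Complex.norm_real, Real.norm_of_nonneg (hf0 _)]
  rwa [hleft, hright] at hnorm'

theorem const_of_semigroupExtends {p : ℝ≥0∞} [Fact (1 ≤ p)] (hp : p ≠ ∞)
    (h : SemigroupExtends X w p) : ∃ c : ℝ, ∀ x, X.a x * w.ρ x = c := by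
  have hp1 : (1 : ℝ) ≤ p.toReal := by
    rw [← ENNReal.toReal_one]
    exact ENNReal.toReal_mono hp Fact.out
  have hp0 : 0 < p.toReal := by linarith
  have hh0 := X.timeDensity_pos w
  -- Multiplication by this `k` carries `L_p` of the weighted measure isometrically to `L_p(du)`.
  set k : ℝ → ℝ := fun u => X.timeDensity w u ^ p.toReal⁻¹ with hk
  have hk0 : ∀ u, 0 < k u := fun u => Real.rpow_pos_of_pos (hh0 u) _
  have hkc : Continuous k :=
    (X.continuous_timeDensity w).rpow_const fun u => Or.inl (hh0 u).ne'
  have hkp : ∀ u, k u ^ p.toReal = X.timeDensity w u := fun u => by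
    rw [hk, ← Real.rpow_mul (hh0 u).le, inv_mul_cancel₀ hp0.ne', Real.rpow_one]
  have hkp' : ∀ u, ENNReal.ofReal (k u) ^ p.toReal = ENNReal.ofReal (X.timeDensity w u) :=
    fun u => by rw [ENNReal.ofReal_rpow_of_pos (hk0 u), hkp]
  have hconst := eq_of_kernel_contractive hp1 (continuous_gauss 1) (gauss_pos one_pos)
    (gauss_neg 1) (lintegral_gauss one_pos) (lintegral_gauss_mul_sq_ne_top one_pos) hkc hk0
    fun f hf hfs hf0 => by
      have hle := lintegral_convolution_le_of_semigroupExtends hp h one_pos hf hfs hf0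
      refine le_trans (le_of_eq (lintegral_congr fun u => ?_))
        (hle.trans_eq (lintegral_congr fun u => ?_))
      · rw [ENNReal.mul_rpow_of_nonneg _ _ hp0.le, hkp', NNReal.coe_one]
      · rw [Real.mul_rpow (hk0 u).le (hf0 u), hkp, ENNReal.ofReal_mul (hh0 u).le,
          ENNReal.ofReal_rpow_of_nonneg (hf0 u) hp0.le]
  refine ⟨X.timeDensity w 0, fun x => ?_⟩
  rw [← hkp 0, ← hconst (X.time x) 0, hkp, Coefficient.timeDensity, X.timeIso_symm_time]

end VectorFieldSemigroup

end

theorem proposition3p3 (X : VectorFieldSemigroup.Coefficient) (w : VectorFieldSemigroup.Density) :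
    List.TFAE [
      ∃ (p : ℝ≥0∞) (_ : Fact (1 ≤ p)), p ≠ ∞ ∧ VectorFieldSemigroup.GroupExtends X w p,
      ∀ (p : ℝ≥0∞) [Fact (1 ≤ p)], p ≠ ∞ → VectorFieldSemigroup.GroupExtends X w p,
      ∃ (p : ℝ≥0∞) (_ : Fact (1 ≤ p)), p ≠ ∞ ∧ VectorFieldSemigroup.SemigroupExtends X w p,
      ∀ (p : ℝ≥0∞) [Fact (1 ≤ p)], p ≠ ∞ → VectorFieldSemigroup.SemigroupExtends X w p,
      ∃ c : ℝ, ∀ x, X.a x * w.ρ x = c] := by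
  tfae_have 5 → 2 := fun ⟨_, hc⟩ p _ hp => VectorFieldSemigroup.groupExtends_of_const hc p hp
  tfae_have 2 → 1 := fun h => ⟨1, ⟨le_rfl⟩, ENNReal.one_ne_top, h 1 ENNReal.one_ne_top⟩
  tfae_have 2 → 4 := fun h p _ hp => VectorFieldSemigroup.semigroupExtends_of_groupExtends (h p hp)
  tfae_have 1 → 3 := fun ⟨p, hp1, hp, h⟩ =>
    ⟨p, hp1, hp, VectorFieldSemigroup.semigroupExtends_of_groupExtends h⟩
  tfae_have 4 → 3 := fun h => ⟨1, ⟨le_rfl⟩, ENNReal.one_ne_top, h 1 ENNReal.one_ne_top⟩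
  tfae_have 3 → 5 := fun ⟨_, _, hp, h⟩ => VectorFieldSemigroup.const_of_semigroupExtends hp h
  tfae_finish
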